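/- Let $\mathbf V$ be a finite set of event types. A (multivariate) instantaneous causal structure on $\mathbf V$ is a pair $(\mathcal G,\Theta)$ of a directed acyclic graph $\mathcal G$ on $\mathbf V$ and parameters $\Theta=\big((\alpha_{v',v})_{v',v\in\mathbf V},(\mu_v)_{v\in\mathbf V}\big)$ of non-negative reals such that $\alpha_{v',v}>0$ if $v'\to v$ is an edge of $\mathcal G$, $\alpha_{v',v}=0$ otherwise, and $\mu_v>0$ for every vertex $v$ without parents. Random counts $X=(X_v)_{v\in\mathbf V}$ with values in $\{0,1,2,\dots\}$ (the numbers of events in one time slot) are said to follow $(\mathcal G,\Theta)$ if almost surely $$X_v=\sum_{v'\in\mathbf V}\ \sum_{i=1}^{X_{v'}}\xi^{(v',v)}_i+\epsilon_v\qquad(v\in\mathbf V),$$ where $\epsilon_v\sim\operatorname{Pois}(\mu_v)$, $\xi_i^{(v',v)}\sim\operatorname{Pois}(\alpha_{v',v})$, and all the variables $\epsilon_v$, $\xi^{(v',v)}_i$ ($v,v'\in\mathbf V$, $i\ge1$) are jointly independent (causal sufficiency: all variables of $\mathbf V$ are observed and there are no hidden common causes). Theorem. Let $X$ follow $(\mathcal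 G,\Theta)$, and suppose that its distribution is causally faithful to $\mathcal G$: for all pairwise disjoint $A,B,C\subseteq\mathbf V$, if $X_A$ and $X_B$ are conditionally independent given $X_C$, then $A$ and $B$ are d-separated by $C$ in $\mathcal G$. Then the causal structure is identifiable from the joint distribution: if $\hat X$ follows an instantaneous causal structure $(\hat{\mathcal G},\hat\Theta)$ on the same $\mathbf V$ (with $\hat X$ possibly on another probability space) and $\hat X$ has the same joint distribution as $X$, then $\hat{\mathcal G}=\mathcal G$ and $\hat\Theta=\Theta$. In other words, no other causal structure is distribution equivalent to $(\mathcal G,\Theta)$. -/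

import Mathlib

open MeasureTheory ProbabilityTheory
open scoped NNReal

namespace SHP

/-- A directed graph is acyclic when no vertex can be reached from itself by a directed path with
at least one edge (in particular there are no loops). -/
def IsDAG {V : Type*} (G : Digraph V) : Prop :=
  ∀ v, ¬ Relation.TransGen G.Adj v v

/-- A multivariate instantaneous causal structure: a DAG `graph` on the set `V` of event types and
the parameters `Θ = (α, μ)`, where `α v' v` is the strength of the influence `v' → v` and `μ v` is
the immigration intensity of `v`. Edges have positive strength, non-edges have strength zero, and
the immigration of a root (a vertex without parents) is positive. -/
structure InstantaneousModel (V : Type*) where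
  graph : Digraph V
  α : V → V → ℝ≥0
  μ : V → ℝ≥0
  isDAG : IsDAG graph
  α_pos : ∀ v' v, graph.Adj v' v → 0 < α v' v
  α_eq_zero : ∀ v' v, ¬ graph.Adj v' v → α v' v = 0
  μ_pos : ∀ v, (∀ v', ¬ graph.Adj v' v) → 0 < μ v

/-- The random counts `X v`, `v ∈ V`, (of one time slot) obey the structural equations
`X_v = ∑_{v'} α_{v',v} ∘ X_{v'} + ε_v`, where `α_{v',v} ∘ X_{v'} = ∑_{i < X_{v'}} ξ_i^{(v',v)}`, with
`ε_v ∼ Pois(μ_v)` and `ξ_i^{(v',v)} ∼ Pois(α_{v',v})`. All the exogenous variables, that is the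
immigrations and the offspring counts, are jointly independent: there is no unobserved common
cause of the observed variables (causal sufficiency). -/
def InstantaneousModel.Generates {V : Type*} [Fintype V] (M : InstantaneousModel V)
    {Ω : Type*} [MeasurableSpace Ω] (P : Measure Ω) (X : V → Ω → ℕ) : Prop :=
  (∀ v, Measurable (X v)) ∧
  ∃ (ε : V → Ω → ℕ) (ξ : V → V → ℕ → Ω → ℕ),
    (∀ v, Measurable (ε v)) ∧
    (∀ v' v i, Measurable (ξ v' v i)) ∧
    (∀ v, HasLaw (ε v) (poissonMeasure (M.μ v)) P) ∧
    (∀ v' v i, HasLaw (ξ v' v i) (poissonMeasure (M.α v' v)) P) ∧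
    iIndepFun (fun j : V ⊕ (V × V × ℕ) =>
      Sum.elim ε (fun p : V × V × ℕ => ξ p.1 p.2.1 p.2.2) j) P ∧
    ∀ v, ∀ᵐ ω ∂P, X v ω = (∑ v', ∑ i ∈ Finset.range (X v' ω), ξ v' v i ω) + ε v ω

/-- The joint distribution of the counts `X v`, `v ∈ V`. -/
noncomputable abbrev jointLaw {V Ω : Type*} [MeasurableSpace Ω] (P : Measure Ω)
    (X : V → Ω → ℕ) : Measure (V → ℕ) :=
  P.map (fun ω v => X v ω)

/-- `p` is a path of the skeleton of `G`: its vertices are distinct and consecutive ones are joined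
by an edge, in either direction. -/
def IsPath {V : Type*} (G : Digraph V) (p : List V) : Prop :=
  p.Nodup ∧ p.IsChain (fun u v => G.Adj u v ∨ G.Adj v u)

/-- The path `p` is active (not blocked) given `C`: each collider `u → w ← v` on it has a descendant
in `C` (possibly `w` itself), and no other interior vertex of it lies in `C`. -/
def IsActive {V : Type*} (G : Digraph V) (C : Set V) (p : List V) : Prop :=
  ∀ u w v, [u, w, v] <:+: p →
    ((G.Adj u w ∧ G.Adj v w) → ∃ d ∈ C, Relation.ReflTransGen G.Adj w d) ∧
    (¬ (G.Adj u w ∧ G.Adj v w) → w ∉ C)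

/-- `A` and `B` are d-separated by `C`: no path from `A` to `B` is active given `C`. -/
def DSep {V : Type*} (G : Digraph V) (A B C : Set V) : Prop :=
  ∀ p : List V, IsPath G p → (∃ a ∈ A, p.head? = some a) → (∃ b ∈ B, p.getLast? = some b) →
    ¬ IsActive G C p

/-- The coordinates in `S` of a vector of counts. -/
def coords {V : Type*} (S : Set V) (x : V → ℕ) : S → ℕ := fun v => x v

theorem measurable_coords {V : Type*} (S : Set V) : Measurable (coords S) :=
  measurable_pi_lambda _ fun v => measurable_pi_apply (v : V)

/-- Causal faithfulness of a distribution `ν` of counts to `G`: whenever the coordinates in `A` and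
in `B` are conditionally independent given those in `C`, the sets `A` and `B` are d-separated by `C`
in `G`, for all pairwise disjoint `A`, `B`, `C`. -/
def Faithful {V : Type*} [Finite V] (G : Digraph V) (ν : Measure (V → ℕ)) [IsFiniteMeasure ν] :
    Prop :=
  ∀ A B C : Set V, Disjoint A B → Disjoint A C → Disjoint B C →
    CondIndepFun (MeasurableSpace.comap (coords C) inferInstance) (measurable_coords C).comap_le
      (coords A) (coords B) ν → DSep G A B C

end SHP

/-! The parameters are read off the joint probability mass function, going backwards along the graph
one sink at a time.

Since the graph is acyclic, the structural equations determine the counts, and independence of the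
exogenous variables gives the mass function of `X` at `x` as the product over `v` of the Poisson
probabilities of `x v` at the rates `λ_v(x) = μ_v + ∑_u α_{u,v} x_u`
(`InstantaneousModel.Generates.jointLaw_singleton`). At vectors of positive counts all the rates,
hence all the factors, are positive, so that logarithmic arguments and cancellation are available.

Up to factorials, which two models share, the product as a function of `x v` is log-linear if `v` is
a sink. If `v` has a child `c`, it is strictly log-concave where `x c > 0`, because of the factor
`λ_c(x) ^ x c`, whose base is a nonconstant affine function of `x v`. So two models with the same
joint law have the same sinks (`weight_probe_sq_eq`, `weight_probe_sq_lt`). The growth of the product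
in `x v` at a common sink `v` is `λ_v(x)`, which determines the parameters of `v`
(`prod_weight_update`, `α_eq_and_μ_eq_of_rate_eq`). The factor of `v` then cancels, and the argument
is repeated on the remaining vertices (`parameters_eq_of_prod_weight_eq`). -/

namespace SHP

/-! ### Sums of independent Poisson variables -/

theorem poissonMeasure_zero : poissonMeasure 0 = Measure.dirac 0 := by
  refine Measure.ext_of_singleton fun n => ?_
  rw [poissonMeasure_singleton]
  rcases Nat.eq_zero_or_pos n with rfl | hn
  · simp
  · simp [hn.ne', hn.ne]

theorem hasLaw_sum_poissonMeasure {Ω ι : Type*} [MeasurableSpace Ω] {P : Measure Ω}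
    [IsProbabilityMeasure P] {f : ι → Ω → ℕ} {r : ι → ℝ≥0} (hf : ∀ j, Measurable (f j))
    (hind : iIndepFun f P) (hlaw : ∀ j, HasLaw (f j) (poissonMeasure (r j)) P) (s : Finset ι) :
    HasLaw (∑ j ∈ s, f j) (poissonMeasure (∑ j ∈ s, r j)) P := by
  classical
  induction s using Finset.induction_on with
  | empty =>
    refine ⟨by fun_prop, ?_⟩
    rw [Finset.sum_empty, Finset.sum_empty, poissonMeasure_zero]
    exact (Measure.map_const P (0 : ℕ)).trans (by simp)
  | insert i s hi ih =>
    rw [Finset.sum_insert hi, Finset.sum_insert hi]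
    exact (hind.indepFun_finsetSum_of_notMem hf hi).symm.hasLaw_add_poissonMeasure (hlaw i) ih

/-- Sums of independent variables over pairwise disjoint blocks of indices are independent. -/
theorem measure_iInter_sum_eq {Ω ι κ : Type*} [MeasurableSpace Ω] {P : Measure Ω}
    [IsProbabilityMeasure P] {f : ι → Ω → ℕ} (hf : ∀ j, Measurable (f j)) (hind : iIndepFun f P)
    {s : κ → Finset ι} (hs : Pairwise fun k l => Disjoint (s k) (s l)) (x : κ → ℕ)
    (T : Finset κ) :
    P {ω | ∀ k ∈ T, ∑ j ∈ s k, f j ω = x k} = ∏ k ∈ T, P {ω | ∑ j ∈ s k, f j ω = x k} := by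
  classical
  induction T using Finset.induction_on with
  | empty => simp
  | insert k T hk ih =>
    have hdisj : Disjoint (s k) (T.biUnion s) := by
      rw [Finset.disjoint_biUnion_right]
      exact fun l hl => hs (by rintro rfl; exact hk hl)
    have h := (hind.indepFun_finset (s k) (T.biUnion s) hdisj hf).measure_inter_preimage_eq_mul
      {y | ∑ j, y j = x k}
      {y | ∀ l (hl : l ∈ T), ∑ j : s l,
        y ⟨j, Finset.mem_biUnion.2 ⟨l, hl, j.2⟩⟩ = x l}
      (Set.to_countable _).measurableSet (Set.to_countable _).measurableSet
    have h₁ : (fun a (i : s k) => f i a) ⁻¹' {y | ∑ j, y j = x k} =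
        {ω | ∑ j ∈ s k, f j ω = x k} := by
      ext ω
      simp only [Set.mem_preimage, Set.mem_ofPred_eq]
      rw [Finset.sum_coe_sort (s k) (fun j => f j ω)]
    have h₂ : (fun a (i : T.biUnion s) => f i a) ⁻¹' {y | ∀ l (hl : l ∈ T), ∑ j : s l,
        y ⟨j, Finset.mem_biUnion.2 ⟨l, hl, j.2⟩⟩ = x l} =
        {ω | ∀ l ∈ T, ∑ j ∈ s l, f j ω = x l} := by
      ext ω
      simp only [Set.mem_preimage, Set.mem_ofPred_eq]
      refine forall₂_congr fun l hl => ?_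
      rw [Finset.sum_coe_sort (s l) (fun j => f j ω)]
    rw [h₁, h₂, ih] at h
    rw [Finset.prod_insert hk, ← h]
    congr 1
    ext ω
    simp

/-! ### Finite directed acyclic graphs -/

theorem IsDAG.wellFounded {V : Type*} [Finite V] {G : Digraph V} (hG : IsDAG G) :
    WellFounded G.Adj := by
  have : Std.Irrefl (Relation.TransGen G.Adj) := ⟨hG⟩
  exact Subrelation.wf (fun h => Relation.TransGen.single h)
    (Finite.wellFounded_of_trans_of_irrefl (Relation.TransGen G.Adj))

theorem IsDAG.exists_sink {V : Type*} [Finite V] {G : Digraph V} (hG : IsDAG G) {S : Finset V}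
    (hS : S.Nonempty) : ∃ v ∈ S, ∀ u ∈ S, ¬ G.Adj v u := by
  have : Std.Irrefl (fun u v => Relation.TransGen G.Adj v u) := ⟨hG⟩
  have : IsTrans V (fun u v => Relation.TransGen G.Adj v u) := ⟨fun _ _ _ h h' => h'.trans h⟩
  obtain ⟨v, hv, hmin⟩ := (Finite.wellFounded_of_trans_of_irrefl
    (fun u v => Relation.TransGen G.Adj v u)).has_min (S : Set V) hS
  exact ⟨v, hv, fun u hu h => hmin u hu (.single h)⟩

namespace InstantaneousModel

theorem adj_iff {V : Type*} (M : InstantaneousModel V) (u v : V) : M.graph.Adj u v ↔ M.α u v ≠ 0 :=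
  ⟨fun h => (M.α_pos u v h).ne', fun h => by_contra fun h' => h (M.α_eq_zero u v h')⟩

theorem α_self {V : Type*} (M : InstantaneousModel V) (v : V) : M.α v v = 0 :=
  M.α_eq_zero _ _ fun h => M.isDAG v (.single h)

/-! ### The joint probability mass function -/

section

variable {V : Type*} [Fintype V]

/-- The conditional intensity `μ_v + ∑_u α_{u,v} x_u` of the count of `v` when the other counts
are those of `x`; only the parents of `v` contribute. -/
noncomputable def rate (M : InstantaneousModel V) (x : V → ℕ) (v : V) : ℝ≥0 :=
  (∑ u, x u • M.α u v) + M.μ v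

/-- The structural equations determine the counts: at almost every `ω`, a vector `x` that solves
them, with `x` itself as the numbers of summands, is the vector of counts. -/
theorem Generates.measure_eq (M : InstantaneousModel V) {Ω : Type*} [MeasurableSpace Ω]
    {P : Measure Ω} {X : V → Ω → ℕ} {ε : V → Ω → ℕ} {ξ : V → V → ℕ → Ω → ℕ}
    (hξ : ∀ v' v i, HasLaw (ξ v' v i) (poissonMeasure (M.α v' v)) P)
    (hX : ∀ v, ∀ᵐ ω ∂P, X v ω = (∑ v', ∑ i ∈ Finset.range (X v' ω), ξ v' v i ω) + ε v ω)
    (x : V → ℕ) :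
    P {ω | (fun v => X v ω) = x} =
      P {ω | ∀ v, (∑ v', ∑ i ∈ Finset.range (x v'), ξ v' v i ω) + ε v ω = x v} := by
  have hzero : ∀ v' v i, ∀ᵐ ω ∂P, ¬ M.graph.Adj v' v → ξ v' v i ω = 0 := by
    intro v' v i
    by_cases h : M.graph.Adj v' v
    · simp [h]
    · have hl := hξ v' v i
      rw [M.α_eq_zero _ _ h, poissonMeasure_zero] at hl
      have : ∀ᵐ n ∂(P.map (ξ v' v i)), n = 0 := by
        rw [hl.map_eq, ae_dirac_iff (p := fun n => n = 0) (MeasurableSet.singleton 0)]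
      filter_upwards [ae_of_ae_map hl.aemeasurable this] with ω hω _ using hω
  refine measure_congr ?_
  filter_upwards [ae_all_iff.2 hX, ae_all_iff.2 fun v' => ae_all_iff.2 fun v =>
    ae_all_iff.2 fun i => hzero v' v i] with ω hω h0
  refine propext ⟨fun h v => ?_, fun h => funext fun v => ?_⟩
  · obtain rfl : (fun v => X v ω) = x := h
    exact (hω v).symm
  · induction v using M.isDAG.wellFounded.induction with
    | _ v ih =>
      rw [hω v, ← h v]
      congr 1
      refine Finset.sum_congr rfl fun u _ => ?_
      by_cases hu : M.graph.Adj u v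
      · rw [ih u hu]
      · simp [h0 u v _ hu]

/-- The joint law factorizes along the graph, each count being conditionally Poisson given its
parents. -/
theorem Generates.jointLaw_singleton {M : InstantaneousModel V} {Ω : Type*} [MeasurableSpace Ω]
    {P : Measure Ω} [IsProbabilityMeasure P] {X : V → Ω → ℕ} (hX : M.Generates P X) (x : V → ℕ) :
    jointLaw P X {x} = ∏ v, poissonMeasure (M.rate x v) {x v} := by
  classical
  obtain ⟨hXm, ε, ξ, hεm, hξm, hε, hξ, hind, heq⟩ := hX
  set f : V ⊕ (V × V × ℕ) → Ω → ℕ := fun j =>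
    Sum.elim ε (fun p : V × V × ℕ => ξ p.1 p.2.1 p.2.2) j with hf
  let r : V ⊕ (V × V × ℕ) → ℝ≥0 := Sum.elim M.μ (fun p => M.α p.1 p.2.1)
  -- the exogenous variables that enter the equation of `v` when the counts are `x`
  let s : V → Finset (V ⊕ (V × V × ℕ)) := fun v =>
    ({v} : Finset V).disjSum (((Finset.univ : Finset V).sigma fun u => Finset.range (x u)).image
      fun p => (p.1, v, p.2))
  have hfm : ∀ j, Measurable (f j) := by rintro (v | p) <;> simp [hf, hεm, hξm]
  have hlaw : ∀ j, HasLaw (f j) (poissonMeasure (r j)) P := by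
    rintro (v | p)
    exacts [hε v, hξ _ _ _]
  have hs : Pairwise fun v w => Disjoint (s v) (s w) := by
    intro v w hvw
    rw [Finset.disjoint_left]
    rintro (u | ⟨a, b, c⟩) h₁ h₂
    · simp only [s, Finset.inl_mem_disjSum, Finset.mem_singleton] at h₁ h₂
      exact hvw (h₁.symm.trans h₂)
    · simp only [s, Finset.inr_mem_disjSum, Finset.mem_image, Prod.mk.injEq] at h₁ h₂
      obtain ⟨_, _, _, rfl, _⟩ := h₁
      obtain ⟨_, _, _, rfl, _⟩ := h₂
      exact hvw rfl
  have hsum : ∀ {A : Type _} [AddCommMonoid A] (g : V ⊕ (V × V × ℕ) → A) (v : V),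
      ∑ j ∈ s v, g j =
        (∑ u, ∑ i ∈ Finset.range (x u), g (.inr (u, v, i))) + g (.inl v) := by
    intro A _ g v
    rw [Finset.sum_disjSum, Finset.sum_singleton, Finset.sum_image, Finset.sum_sigma, add_comm]
    rintro ⟨a, b⟩ _ ⟨c, d⟩ _ h
    simp only [Prod.mk.injEq] at h
    obtain ⟨rfl, _, rfl⟩ := h
    rfl
  have hrate : ∀ v, ∑ j ∈ s v, r j = M.rate x v := by
    intro v
    rw [hsum]
    simp [r, rate]
  have hmeas : Measurable fun ω v => X v ω := measurable_pi_lambda _ hXm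
  rw [jointLaw, Measure.map_apply hmeas (MeasurableSet.singleton x)]
  change P {ω | (fun v => X v ω) = x} = _
  rw [Generates.measure_eq M hξ heq x]
  have h := measure_iInter_sum_eq hfm hind hs x Finset.univ
  simp only [Finset.mem_univ, true_implies] at h
  have hset : {ω | ∀ v, (∑ v', ∑ i ∈ Finset.range (x v'), ξ v' v i ω) + ε v ω = x v} =
      {ω | ∀ v, ∑ j ∈ s v, f j ω = x v} := by
    ext ω
    refine forall_congr' fun v => ?_
    rw [hsum (fun j => f j ω)]
    rfl
  rw [hset, h]
  refine Finset.prod_congr rfl fun v _ => ?_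
  have hv := hasLaw_sum_poissonMeasure hfm hind hlaw (s v)
  rw [← hrate, ← hv.map_eq, Measure.map_apply_of_aemeasurable hv.aemeasurable
    (MeasurableSet.singleton _)]
  congr 1
  ext ω
  simp

end

/-! ### Recovering the parameters from the mass function -/

/-- The vector with count `k` at `v` and count one elsewhere. -/
def probe {V : Type*} [DecidableEq V] (v : V) (k : ℕ) : V → ℕ := Function.update 1 v k

theorem probe_pos {V : Type*} [DecidableEq V] (v : V) {k : ℕ} (hk : 0 < k) (u : V) :
    0 < probe v k u := by
  by_cases hu : u = v
  · subst hu
    simpa [probe]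
  · simp [probe, hu]

variable {V : Type*} [Fintype V]

/-- The Poisson weight of `x v` at the rate that `x` prescribes, without the factor `1 / (x v)!`,
which does not depend on the parameters. -/
noncomputable def weight (M : InstantaneousModel V) (x : V → ℕ) (v : V) : ℝ :=
  Real.exp (-M.rate x v) * (M.rate x v : ℝ) ^ x v

/-- Every rate is positive at a vector of positive counts: a vertex without parents has positive
immigration, any other one has a parent of positive count. -/
theorem rate_pos (M : InstantaneousModel V) {x : V → ℕ} (hx : ∀ u, 0 < x u) (v : V) :
    0 < M.rate x v := by
  by_cases h : ∃ u, M.graph.Adj u v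
  · obtain ⟨u, hu⟩ := h
    have h₁ : 0 < x u • M.α u v := nsmul_pos (M.α_pos _ _ hu) (hx u).ne'
    have h₂ : x u • M.α u v ≤ ∑ w, x w • M.α w v :=
      Finset.single_le_sum (f := fun w => x w • M.α w v) (fun _ _ => zero_le) (Finset.mem_univ u)
    exact (h₁.trans_le h₂).trans_le le_self_add
  · exact (M.μ_pos v (not_exists.1 h)).trans_le le_add_self

theorem weight_pos (M : InstantaneousModel V) {x : V → ℕ} (hx : ∀ u, 0 < x u) (v : V) :
    0 < M.weight x v := by
  have := M.rate_pos hx v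
  unfold weight
  positivity

theorem rate_update_add [DecidableEq V] (M : InstantaneousModel V) (x : V → ℕ) (v u : V)
    (k l : ℕ) :
    M.rate (Function.update x v (k + l)) u = M.rate (Function.update x v k) u + l • M.α v u := by
  have h : ∀ w, Function.update x v (k + l) w • M.α w u =
      Function.update x v k w • M.α w u + if w = v then l • M.α v u else 0 := by
    intro w
    by_cases hw : w = v
    · subst hw
      simp [add_smul]
    · simp [hw]
  simp only [rate, h, Finset.sum_add_distrib]
  simp only [Finset.sum_ite_eq', Finset.mem_univ, if_true]
  exact add_right_comm _ _ _

theorem rate_update [DecidableEq V] (M : InstantaneousModel V) (x : V → ℕ) {v u : V}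
    (h : M.α v u = 0) (k : ℕ) : M.rate (Function.update x v k) u = M.rate x u := by
  refine congrArg (· + M.μ u) (Finset.sum_congr rfl fun w _ => ?_)
  by_cases hw : w = v
  · subst hw
    simp [h]
  · simp [hw]

theorem weight_update [DecidableEq V] (M : InstantaneousModel V) (x : V → ℕ) {v u : V}
    (h : M.α v u = 0) (huv : u ≠ v) (k : ℕ) :
    M.weight (Function.update x v k) u = M.weight x u := by
  simp [weight, M.rate_update x h, huv]

theorem weight_update_self [DecidableEq V] (M : InstantaneousModel V) (x : V → ℕ) (v : V)
    (k : ℕ) :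
    M.weight (Function.update x v k) v = Real.exp (-M.rate x v) * (M.rate x v : ℝ) ^ k := by
  simp [weight, M.rate_update x (M.α_self v)]

theorem Generates.prod_weight_eq {M M' : InstantaneousModel V} {Ω Ω' : Type*} [MeasurableSpace Ω]
    [MeasurableSpace Ω'] {P : Measure Ω} [IsProbabilityMeasure P] {P' : Measure Ω'}
    [IsProbabilityMeasure P'] {X : V → Ω → ℕ} {X' : V → Ω' → ℕ} (hX : M.Generates P X)
    (hX' : M'.Generates P' X') (hlaw : jointLaw P' X' = jointLaw P X) (x : V → ℕ) :
    ∏ v, M.weight x v = ∏ v, M'.weight x v := by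
  have key : ∀ N : InstantaneousModel V,
      (∏ v, poissonMeasure (N.rate x v) {x v}).toReal =
        (∏ v, N.weight x v) / ∏ v, ((x v).factorial : ℝ) := by
    intro N
    rw [ENNReal.toReal_prod, ← Finset.prod_div_distrib]
    exact Finset.prod_congr rfl fun v _ => poissonMeasure_real_singleton _ _
  have h := hX'.jointLaw_singleton x
  rw [hlaw, hX.jointLaw_singleton x] at h
  have h' := congrArg ENNReal.toReal h
  rw [key, key] at h'
  have hne : ∏ v, ((x v).factorial : ℝ) ≠ 0 :=
    Finset.prod_ne_zero_iff.2 fun v _ => by positivity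
  exact (div_left_inj' hne).1 h'

section

variable [DecidableEq V]

/-- Along the count of `v`, the weights of the other vertices are log-concave, strictly so for the
children of `v`; the weight of `v` itself is log-linear. -/
theorem weight_probe_sq (M : InstantaneousModel V) (v u : V) :
    M.weight (probe v 1) u * M.weight (probe v 3) u ≤ M.weight (probe v 2) u ^ 2 ∧
      (M.weight (probe v 1) u * M.weight (probe v 3) u = M.weight (probe v 2) u ^ 2 ↔
        M.α v u = 0) := by
  by_cases huv : u = v
  · subst huv
    simp only [probe, weight_update_self, M.α_self, iff_true]
    refine ⟨le_of_eq ?_, ?_⟩ <;> ring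
  · have h₂ : M.rate (probe v 2) u = M.rate (probe v 1) u + M.α v u := by
      have h := M.rate_update_add 1 v u 1 1
      rw [one_smul] at h
      exact h
    have h₃ : M.rate (probe v 3) u = M.rate (probe v 1) u + 2 * M.α v u := by
      have h := M.rate_update_add 1 v u 1 2
      rw [nsmul_eq_mul, Nat.cast_ofNat] at h
      exact h
    have hu : ∀ k, probe v k u = 1 := fun k => by simp [probe, huv]
    set a : ℝ := (M.α v u : ℝ) with ha
    set b : ℝ := (M.rate (probe v 1) u : ℝ) with hb
    -- the rates of `u` are `b`, `b + a`, `b + 2 * a`, and `(b + a) ^ 2 - b * (b + 2 * a) = a ^ 2`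
    have key : M.weight (probe v 2) u ^ 2 - M.weight (probe v 1) u * M.weight (probe v 3) u =
        Real.exp (-b - a) ^ 2 * a ^ 2 := by
      have he : Real.exp (-b) * Real.exp (-(b + 2 * a)) = Real.exp (-b - a) ^ 2 := by
        rw [← Real.exp_add, ← Real.exp_nat_mul]
        congr 1
        push_cast
        ring
      simp only [weight, hu, pow_one, h₂, h₃, NNReal.coe_add, NNReal.coe_mul, NNReal.coe_ofNat,
        ← ha, ← hb]
      rw [show -(b + a) = -b - a by ring]
      linear_combination (-(b * (b + 2 * a))) * he
    refine ⟨by nlinarith [sq_nonneg (Real.exp (-b - a) * a)], ?_⟩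
    rw [eq_comm, ← sub_eq_zero, key]
    have := (Real.exp_pos (-b - a)).ne'
    simp [ha]

theorem weight_probe_sq_lt (M : InstantaneousModel V) {S : Finset V} {v c : V} (hc : c ∈ S)
    (hvc : M.α v c ≠ 0) :
    (∏ u ∈ S, M.weight (probe v 1) u) * ∏ u ∈ S, M.weight (probe v 3) u <
      (∏ u ∈ S, M.weight (probe v 2) u) ^ 2 := by
  rw [← Finset.prod_mul_distrib, ← Finset.prod_pow]
  refine Finset.prod_lt_prod (fun u _ => ?_) (fun u _ => (M.weight_probe_sq v u).1) ⟨c, hc, ?_⟩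
  · exact mul_pos (M.weight_pos (probe_pos v one_pos) u) (M.weight_pos (probe_pos v three_pos) u)
  · exact lt_of_le_of_ne (M.weight_probe_sq v c).1 fun h => hvc ((M.weight_probe_sq v c).2.1 h)

theorem weight_probe_sq_eq (M : InstantaneousModel V) {S : Finset V} {v : V}
    (hv : ∀ u ∈ S, M.α v u = 0) :
    (∏ u ∈ S, M.weight (probe v 1) u) * ∏ u ∈ S, M.weight (probe v 3) u =
      (∏ u ∈ S, M.weight (probe v 2) u) ^ 2 := by
  rw [← Finset.prod_mul_distrib, ← Finset.prod_pow]
  exact Finset.prod_congr rfl fun u hu => (M.weight_probe_sq v u).2.2 (hv u hu)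

/-- At a sink `v` of `S`, raising the count of `v` from one to two multiplies the product of the
weights by the rate of `v`. -/
theorem prod_weight_update (M : InstantaneousModel V) {S : Finset V} {v : V} (hvS : v ∈ S)
    (hv : ∀ u ∈ S, M.α v u = 0) (x : V → ℕ) :
    ∏ u ∈ S, M.weight (Function.update x v 2) u =
      (∏ u ∈ S, M.weight (Function.update x v 1) u) * M.rate x v := by
  rw [← Finset.mul_prod_erase _ _ hvS, ← Finset.mul_prod_erase _ _ hvS, weight_update_self,
    weight_update_self]
  have h : ∀ k, ∏ u ∈ S.erase v, M.weight (Function.update x v k) u =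
      ∏ u ∈ S.erase v, M.weight x u := fun k =>
    Finset.prod_congr rfl fun u hu =>
      M.weight_update x (hv u (Finset.mem_of_mem_erase hu)) (Finset.ne_of_mem_erase hu) k
  rw [h, h]
  ring

/-- The rate of `v` at vectors of positive counts, an affine function of the counts, determines its
coefficients. -/
theorem α_eq_and_μ_eq_of_rate_eq {M M' : InstantaneousModel V} {v : V}
    (h : ∀ x : V → ℕ, (∀ u, 0 < x u) → M'.rate x v = M.rate x v) :
    (∀ u, M'.α u v = M.α u v) ∧ M'.μ v = M.μ v := by
  have hα : ∀ u, M'.α u v = M.α u v := by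
    intro u
    have h₁ := h (probe u 1) (probe_pos u one_pos)
    have h₂ := h (probe u 2) (probe_pos u two_pos)
    rw [probe, M.rate_update_add 1 u v 1 1, M'.rate_update_add 1 u v 1 1] at h₂
    rw [probe] at h₁
    rw [h₁] at h₂
    simpa using h₂
  refine ⟨hα, ?_⟩
  have h₁ := h 1 fun _ => one_pos
  simp only [rate, hα] at h₁
  exact add_left_cancel h₁

end

/-- If the products over `S` of the weights of two models agree at all vectors of positive counts,
then the models have the same parameters at the vertices of `S`. -/
theorem parameters_eq_of_prod_weight_eq {M M' : InstantaneousModel V} (S : Finset V)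
    (h : ∀ x : V → ℕ, (∀ u, 0 < x u) → ∏ v ∈ S, M.weight x v = ∏ v ∈ S, M'.weight x v) :
    ∀ v ∈ S, (∀ u, M'.α u v = M.α u v) ∧ M'.μ v = M.μ v := by
  classical
  induction S using Finset.strongInduction with
  | H S ih =>
    rcases S.eq_empty_or_nonempty with rfl | hS
    · simp
    obtain ⟨v, hvS, hv⟩ := M.isDAG.exists_sink hS
    replace hv : ∀ u ∈ S, M.α v u = 0 := fun u hu => M.α_eq_zero _ _ (hv u hu)
    -- a child of `v` in `M'` would make the common product strictly log-concave along the count of `v`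
    have hv' : ∀ u ∈ S, M'.α v u = 0 := by
      by_contra! hne
      obtain ⟨c, hc, hvc⟩ := hne
      have hlt := M'.weight_probe_sq_lt hc hvc
      rw [← h _ (probe_pos v one_pos), ← h _ (probe_pos v two_pos), ← h _ (probe_pos v three_pos),
        M.weight_probe_sq_eq hv] at hlt
      exact lt_irrefl _ hlt
    have hrate : ∀ x : V → ℕ, (∀ u, 0 < x u) → M'.rate x v = M.rate x v := by
      intro x hx
      have hpos : ∀ k, 0 < k → ∀ u, 0 < Function.update x v k u := by
        intro k hk u
        by_cases hu : u = v
        · subst hu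
          simpa
        · simpa [hu] using hx u
      have h₂ := h _ (hpos 2 two_pos)
      rw [M.prod_weight_update hvS hv, M'.prod_weight_update hvS hv', h _ (hpos 1 one_pos)] at h₂
      have hne : ∏ u ∈ S, M'.weight (Function.update x v 1) u ≠ 0 :=
        Finset.prod_ne_zero_iff.2 fun u _ => (M'.weight_pos (hpos 1 one_pos) u).ne'
      exact (NNReal.coe_injective (mul_left_cancel₀ hne h₂)).symm
    have hrest := ih (S.erase v) (Finset.erase_ssubset hvS) fun x hx => by
      have hx' := h x hx
      rw [← Finset.mul_prod_erase _ _ hvS, ← Finset.mul_prod_erase _ _ hvS] at hx'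
      have hw : M'.weight x v = M.weight x v := by rw [weight, weight, hrate x hx]
      rw [hw] at hx'
      exact mul_left_cancel₀ (M.weight_pos hx v).ne' hx'
    intro u hu
    by_cases huv : u = v
    · subst huv
      exact α_eq_and_μ_eq_of_rate_eq hrate
    · exact hrest u (Finset.mem_erase.2 ⟨huv, hu⟩)

end InstantaneousModel

end SHP

theorem theorem3 {V : Type*} [Fintype V] (M M' : SHP.InstantaneousModel V)
    {Ω : Type*} [MeasurableSpace Ω] (P : Measure Ω) [IsProbabilityMeasure P] (X : V → Ω → ℕ)
    {Ω' : Type*} [MeasurableSpace Ω'] (P' : Measure Ω') [IsProbabilityMeasure P'] (X' : V → Ω' → ℕ)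
    (hX : M.Generates P X) (hfaithful : SHP.Faithful M.graph (SHP.jointLaw P X))
    (hX' : M'.Generates P' X') (hlaw : SHP.jointLaw P' X' = SHP.jointLaw P X) :
    M'.graph = M.graph ∧ M'.α = M.α ∧ M'.μ = M.μ := by
  have h := SHP.InstantaneousModel.parameters_eq_of_prod_weight_eq Finset.univ fun x _ =>
    hX.prod_weight_eq hX' hlaw x
  have hα : M'.α = M.α := funext₂ fun u v => (h v (Finset.mem_univ v)).1 u
  refine ⟨?_, hα, funext fun v => (h v (Finset.mem_univ v)).2⟩
  ext u v
  rw [M'.adj_iff, M.adj_iff, hα]
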